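/- Let $H$ be a complex Hilbert space and let $B \subseteq B(H)$ be a unital operator algebra, i.e. a norm-closed (not necessarily selfadjoint) subalgebra of $B(H)$ possessing an identity element of norm at most $1$ (not necessarily the identity operator $I_H$). Suppose that $B$ is a dual Banach space: there are a complex Banach space $X$ and a linear isometric isomorphism $B \cong X^*$; the w*-topology of $B$ is the one transported from the weak* topology $\sigma(X^*, X)$. Then the diagonal $\Delta(B) = B \cap B^*$, where $B^* = \{b^* : b \in B\}$, is a $W^*$-algebra, i.e. with the operator norm and the adjoint as involution it is a unital $C^*$-algebra (with the identity of $B$ as identity) that is isometrically isomorphic to the dual of some Banach space. Moreover, for every $b \in \Delta(B)$, the maps $a \mapsto ab$ and $a \mapsto ba$ on $B$ are w*-continuous. -/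

import Mathlib

open scoped Topology

universe u v

/-- A unital operator algebra on a Hilbert space `H`: a norm-closed (not necessarily selfadjoint)
subalgebra `B` of the bounded operators on `H` that has an identity element of norm at most `1`.
The identity of `B` need not be the identity operator of `H`; the bound `≤ 1` rather than `= 1`
only serves to admit the zero algebra. -/
structure UnitalOperatorAlgebra (H : Type u) [NormedAddCommGroup H] [InnerProductSpace ℂ H]
    [CompleteSpace H] extends NonUnitalSubalgebra ℂ (H →L[ℂ] H) where
  /-- `B` is closed in the operator norm. -/
  isClosed' : IsClosed carrier
  /-- The identity element of `B`. -/
  unit : H →L[ℂ] H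
  unit_mem : unit ∈ carrier
  unit_mul : ∀ b ∈ carrier, unit * b = b
  mul_unit : ∀ b ∈ carrier, b * unit = b
  norm_unit_le : ‖unit‖ ≤ 1

namespace UnitalOperatorAlgebra

variable {H : Type u} [NormedAddCommGroup H] [InnerProductSpace ℂ H] [CompleteSpace H]

/-- The diagonal `Δ(B) = B ∩ B*`, where `B* = {b* : b ∈ B}`, with the operations, the norm and the
involution of the bounded operators on `H`. -/
noncomputable def diagonal (B : UnitalOperatorAlgebra H) : NonUnitalStarSubalgebra ℂ (H →L[ℂ] H) where
  toNonUnitalSubalgebra := B.toNonUnitalSubalgebra ⊓ star B.toNonUnitalSubalgebra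
  star_mem' := by
    intro a ha
    refine ⟨ha.2, ?_⟩
    change star (star a) ∈ B.toNonUnitalSubalgebra
    rw [star_star]
    exact ha.1

theorem mem_diagonal {B : UnitalOperatorAlgebra H} {a : H →L[ℂ] H} :
    a ∈ B.diagonal ↔ a ∈ B.toNonUnitalSubalgebra ∧ star a ∈ B.toNonUnitalSubalgebra :=
  Iff.rfl

/-- The identity of a unital operator algebra is a contractive idempotent, hence selfadjoint. -/
theorem star_unit (B : UnitalOperatorAlgebra H) : star B.unit = B.unit := by
  have hidem : B.unit * B.unit = B.unit := B.unit_mul _ B.unit_mem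
  have key : star B.unit * B.unit = B.unit := by
    ext x
    have hy : B.unit (B.unit x) = B.unit x := congrArg (fun T : H →L[ℂ] H => T x) hidem
    generalize hyx : B.unit x = y at hy
    change star B.unit (B.unit x) = _
    rw [hyx, ← sub_eq_zero, ← norm_eq_zero]
    have h1 : ‖star B.unit y‖ ≤ ‖y‖ := by
      have h := (star B.unit).le_opNorm y
      rw [norm_star] at h
      nlinarith [B.norm_unit_le, norm_nonneg y]
    have h2 : inner ℂ (star B.unit y) y = inner ℂ y y := by
      rw [ContinuousLinearMap.star_eq_adjoint, ContinuousLinearMap.adjoint_inner_left, hy]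
    have h3 := @norm_sub_sq ℂ H _ _ _ (star B.unit y) y
    rw [h2, inner_self_eq_norm_sq] at h3
    have h4 : ‖star B.unit y - y‖ ^ 2 ≤ 0 := by
      nlinarith [norm_nonneg (star B.unit y), norm_nonneg y]
    nlinarith [norm_nonneg (star B.unit y - y)]
  calc star B.unit = star (star B.unit * B.unit) := by rw [key]
    _ = star B.unit * B.unit := by rw [star_mul, star_star]
    _ = B.unit := key

theorem unit_mem_diagonal (B : UnitalOperatorAlgebra H) : B.unit ∈ B.diagonal :=
  mem_diagonal.2 ⟨B.unit_mem, by rw [star_unit]; exact B.unit_mem⟩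

theorem isClosed_diagonal (B : UnitalOperatorAlgebra H) :
    IsClosed (B.diagonal : Set (H →L[ℂ] H)) :=
  B.isClosed'.inter (B.isClosed'.preimage continuous_star)

/-- `Δ(B)` is a C*-algebra with the operator norm, the adjoint as involution, and the identity of
`B` as identity. -/
noncomputable instance instCStarAlgebraDiagonal (B : UnitalOperatorAlgebra H) :
    CStarAlgebra B.diagonal :=
  letI : IsClosed (B.diagonal : Set (H →L[ℂ] H)) := B.isClosed_diagonal
  letI base : NonUnitalCStarAlgebra B.diagonal :=
    NonUnitalStarSubalgebra.nonUnitalCStarAlgebra B.diagonal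
  letI ring : NormedRing B.diagonal :=
    { base.toNonUnitalNormedRing with
      one := ⟨B.unit, B.unit_mem_diagonal⟩
      one_mul := fun a => Subtype.ext (B.unit_mul _ (mem_diagonal.1 a.2).1)
      mul_one := fun a => Subtype.ext (B.mul_unit _ (mem_diagonal.1 a.2).1) }
  letI alg : NormedAlgebra ℂ B.diagonal :=
    { Algebra.ofModule (R := ℂ) (A := B.diagonal) smul_mul_assoc mul_smul_comm with
      norm_smul_le := base.toNormedSpace.norm_smul_le }
  { ring, base.toStarRing, base.toCompleteSpace, base.toCStarRing, alg, base.toStarModule with }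

end UnitalOperatorAlgebra

/-- The w*-topology that a normed space `E` acquires from an isometric identification `φ` with the
dual of a Banach space `X`: the coarsest topology making all the maps `a ↦ φ a x`, `x ∈ X`,
continuous. -/
noncomputable abbrev weakStarTopology {E : Type u} {X : Type v} [SeminormedAddCommGroup E] [Module ℂ E]
    [NormedAddCommGroup X] [NormedSpace ℂ X] (φ : E ≃ₗᵢ[ℂ] StrongDual ℂ X) :
    TopologicalSpace E :=
  TopologicalSpace.induced (fun a => StrongDual.toWeakDual (φ a)) inferInstance

/-! The two claims are proved separately. For the predual: a contraction `b` in `B` is selfadjoint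
exactly when `‖1 + itb‖ ≤ √(1 + t²)` for all real `t`, where `1` is the identity of `B`. These norm
bounds survive w*-limits, so w*-limits of selfadjoint contractions stay in the diagonal. Through
real and imaginary parts, bounded ultrafilters on the diagonal have w*-limits in it, and
`LinearIsometry.exists_predual` turns this into a predual.

For continuity, the only input from `B(H)` is the operator Cauchy–Schwarz inequality `‖∑ Tᵢ eᵢ‖² ≤
‖∑ Tᵢ²‖ ∑ ‖eᵢ‖²` for selfadjoint `Tᵢ`. It suffices to treat a positive contraction; its functional
calculus makes `C(spectrum)` act on `B` with contractive rows. Let `a → 0` boundedly in the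
w*-topology and `f a → y`. Rows with disjoint supports combine in the `ℓ²` sense, which forces
locality of such limits (`RowContractive.apply_limit_eq_zero`). Near the level `j/n`, `f` is the
constant `j/n`, which contributes nothing to `y`, plus an error of order `1/n`. Gluing the `n + 1`
levels in `ℓ²` gives `‖y‖² = O(1/n)`, so `y = 0`. Continuity at `0` on the unit ball then gives a
map on the predual, by `LinearIsometryEquiv.exists_eq_apply_of_tendsto_zero`. -/

section

open Filter Metric ComplexStarModule

/-! ### Weak* compactness and preduals. -/

section WeakStar

variable {X : Type*} [NormedAddCommGroup X] [NormedSpace ℂ X]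

/-- Bounded ultrafilters in a dual Banach space converge pointwise. -/
theorem Ultrafilter.exists_tendsto_apply_of_norm_le {α : Type*} (U : Ultrafilter α)
    {u : α → StrongDual ℂ X} {r : ℝ} (hu : ∀ᶠ a in (U : Filter α), ‖u a‖ ≤ r) :
    ∃ c : StrongDual ℂ X, ∀ x, Tendsto (fun a => u a x) U (𝓝 (c x)) := by
  have hc := WeakDual.isCompact_closedBall (𝕜 := ℂ) (0 : StrongDual ℂ X) r
  obtain ⟨c, -, hc⟩ := hc.ultrafilter_le_nhds (U.map fun a => StrongDual.toWeakDual (u a)) (by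
    rw [le_principal_iff, Ultrafilter.mem_coe, Ultrafilter.mem_map]
    filter_upwards [hu] with a ha
    simpa using ha)
  refine ⟨WeakDual.toStrongDual c, fun x => ?_⟩
  have h : Tendsto (fun a => StrongDual.toWeakDual (u a)) U (𝓝 c) := hc
  exact ((WeakDual.eval_continuous x).tendsto c).comp h

/-- The dual norm is lower semicontinuous for pointwise convergence. -/
theorem StrongDual.norm_le_of_tendsto_apply {α : Type*} {l : Filter α} [l.NeBot]
    {u : α → StrongDual ℂ X} {c : StrongDual ℂ X} {r : ℝ} (hr : 0 ≤ r)
    (hu : ∀ᶠ a in l, ‖u a‖ ≤ r) (hc : ∀ x, Tendsto (fun a => u a x) l (𝓝 (c x))) : ‖c‖ ≤ r := by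
  refine c.opNorm_le_bound hr fun x => le_of_tendsto (hc x).norm ?_
  filter_upwards [hu] with a ha
  exact (u a).le_of_opNorm_le ha x

/-- A functional on a dual Banach space that tends to `0` along the unit ball near the origin of the
w*-topology is evaluation at a point of the predual. -/
theorem LinearIsometryEquiv.exists_eq_apply_of_tendsto_zero [CompleteSpace X] {E : Type*}
    [NormedAddCommGroup E] [NormedSpace ℂ E] (φ : E ≃ₗᵢ[ℂ] StrongDual ℂ X) (f : StrongDual ℂ E)
    (hf : Tendsto f ((comap (fun (a : E) (x : X) => φ a x) (𝓝 0)) ⊓ 𝓟 (closedBall 0 1)) (𝓝 0)) :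
    ∃ x : X, ∀ a, f a = φ a x := by
  let J₀ : X →L[ℂ] StrongDual ℂ E := (φ.toLinearIsometry.toContinuousLinearMap).flip
  have hJ₀ : ∀ x a, J₀ x a = φ a x := fun x a => rfl
  have hnorm : ∀ x, ‖J₀ x‖ = ‖x‖ := by
    intro x
    refine le_antisymm ((J₀ x).opNorm_le_bound (norm_nonneg x) fun a => ?_) ?_
    · rw [hJ₀, mul_comm, ← φ.norm_map a]
      exact (φ a).le_opNorm x
    · obtain ⟨g, hg1, hg⟩ := exists_dual_vector'' ℂ x
      have h := (J₀ x).le_opNorm (φ.symm g)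
      rw [hJ₀, φ.apply_symm_apply, hg, φ.symm.norm_map] at h
      simp only [RCLike.norm_ofReal, abs_norm] at h
      exact h.trans (mul_le_of_le_one_right (norm_nonneg _) hg1)
  let J : X →ₗᵢ[ℂ] StrongDual ℂ E := ⟨J₀, hnorm⟩
  have hcl : IsClosed (Set.range J) := J.isometry.isClosedEmbedding.isClosed_range
  suffices h : f ∈ closure (Set.range J) by
    rw [hcl.closure_eq] at h
    obtain ⟨x, hx⟩ := h
    exact ⟨x, fun a => by rw [← hx]; rfl⟩
  refine Metric.mem_closure_iff.2 fun ε hε => ?_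
  have h1 := hf (closedBall_mem_nhds 0 (half_pos hε))
  rw [mem_map, mem_inf_principal, mem_comap] at h1
  obtain ⟨t, ht, hts⟩ := h1
  rw [nhds_pi, mem_pi'] at ht
  obtain ⟨F, s, hs, hst⟩ := ht
  -- A w*-neighbourhood of `0` constrains only the finitely many points of `F`, so `f` has norm at
  -- most `ε / 2` on their common kernel `N`. Subtracting a norm-preserving extension of `f|N`
  -- leaves a functional that kills `N`, hence a combination of evaluations at `F`.
  let N : Submodule ℂ E := ⨅ x : F, LinearMap.ker ((J x : StrongDual ℂ E) : E →ₗ[ℂ] ℂ)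
  have hN : ∀ a ∈ N, ‖a‖ ≤ 1 → ‖f a‖ ≤ ε / 2 := by
    intro a ha ha1
    have hmem : a ∈ (fun (a : E) (x : X) => φ a x) ⁻¹' t := by
      refine hst fun x hx => ?_
      have h2 : φ a x = 0 := (Submodule.mem_iInf _).1 ha ⟨x, hx⟩
      change φ a x ∈ s x
      rw [h2]
      exact mem_of_mem_nhds (hs x)
    have := hts hmem (by simpa using ha1)
    simpa using this
  obtain ⟨g, hg, hgn⟩ := exists_extension_norm_eq N (f.comp N.subtypeL)
  have hfn : ‖f.comp N.subtypeL‖ ≤ ε / 2 := by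
    refine ContinuousLinearMap.opNorm_le_of_unit_norm (by positivity) fun a ha => ?_
    exact hN a a.2 (le_of_eq ha)
  have hspan : ((f - g : StrongDual ℂ E) : E →ₗ[ℂ] ℂ) ∈
      Submodule.span ℂ (Set.range fun x : F => ((J x : StrongDual ℂ E) : E →ₗ[ℂ] ℂ)) := by
    refine mem_span_of_iInf_ker_le_ker fun a ha => ?_
    have := hg ⟨a, ha⟩
    simp only [LinearMap.mem_ker]
    change f a - g a = 0
    rw [this]
    exact sub_self _
  have hle : Submodule.span ℂ (Set.range fun x : F => ((J x : StrongDual ℂ E) : E →ₗ[ℂ] ℂ)) ≤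
      LinearMap.range ((ContinuousLinearMap.coeLM ℂ : _ →ₗ[ℂ] (E →ₗ[ℂ] ℂ)) ∘ₗ J.toLinearMap) := by
    rw [Submodule.span_le]
    rintro _ ⟨x, rfl⟩
    exact ⟨x, rfl⟩
  obtain ⟨x, hx⟩ := hle hspan
  have hx : J x = f - g := ContinuousLinearMap.coe_injective hx
  refine ⟨J x, ⟨x, rfl⟩, ?_⟩
  rw [hx, dist_eq_norm, sub_sub_cancel, hgn]
  linarith

/-- Let `j` embed `M` isometrically in the dual of `X`, with a unit ball that is compact for
pointwise convergence. If `Y` is the closure of the range of `X` in the dual of `M`, then `M` is the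
dual of `Y`. -/
theorem LinearIsometry.nonempty_dual_equiv {M Y : Type*} [NormedAddCommGroup M] [NormedSpace ℂ M]
    [NormedAddCommGroup Y] [NormedSpace ℂ Y]
    (j : M →ₗᵢ[ℂ] StrongDual ℂ X) (i : Y →ₗᵢ[ℂ] StrongDual ℂ M)
    (hi : Set.range i = closure (Set.range j.toContinuousLinearMap.flip))
    (hj : ∀ U : Ultrafilter M, (∀ᶠ m in (U : Filter M), ‖m‖ ≤ 1) →
      ∃ c : M, ∀ x, Tendsto (fun m => j m x) U (𝓝 (j c x))) :
    Nonempty (StrongDual ℂ Y ≃ₗᵢ[ℂ] M) := by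
  let R : X →L[ℂ] StrongDual ℂ M := j.toContinuousLinearMap.flip
  have hRi : ∀ x, ∃ y, i y = R x := fun x => by
    rw [← Set.mem_range, hi]
    exact subset_closure ⟨x, rfl⟩
  choose q hq using hRi
  have hR : ∀ x, ‖R x‖ ≤ ‖x‖ := fun x =>
    (R x).opNorm_le_bound (norm_nonneg x) fun m => by
      have := (j m).le_opNorm x
      rw [j.norm_map, mul_comm] at this
      exact this
  let J : M →L[ℂ] StrongDual ℂ Y := i.toContinuousLinearMap.flip
  have hJ : ∀ m (y : Y), J m y = i y m := fun m y => rfl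
  have hJq : ∀ m x, J m (q x) = j m x := fun m x => by
    rw [hJ, hq]
    rfl
  have hqn : ∀ x, ‖q x‖ ≤ ‖x‖ := fun x => by
    rw [← i.norm_map, hq]
    exact hR x
  have hJn : ∀ m, ‖J m‖ = ‖m‖ := by
    intro m
    refine le_antisymm ((J m).opNorm_le_bound (norm_nonneg m) fun y => ?_) ?_
    · rw [hJ, mul_comm, ← i.norm_map]
      exact (i y).le_opNorm m
    · rw [← j.norm_map]
      refine (j m).opNorm_le_bound (norm_nonneg _) fun x => ?_
      have h := (J m).le_opNorm (q x)
      rw [hJq] at h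
      exact h.trans (mul_le_mul_of_nonneg_left (hqn x) (norm_nonneg _))
  -- Pointwise convergence on the range of `R` passes to its closure.
  have hconv : ∀ U : Ultrafilter M, (∀ᶠ m in (U : Filter M), ‖m‖ ≤ 1) →
      ∃ c : M, ‖c‖ ≤ 1 ∧ ∀ y : Y, Tendsto (fun m => J m y) U (𝓝 (J c y)) := by
    intro U hU
    obtain ⟨c, hc⟩ := hj U hU
    obtain ⟨d, hd⟩ := U.exists_tendsto_apply_of_norm_le (u := fun m => J m) (r := 1)
      (by simpa only [hJn] using hU)
    have hc1 : ‖c‖ ≤ 1 := by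
      rw [← j.norm_map]
      exact StrongDual.norm_le_of_tendsto_apply zero_le_one (by simpa only [j.norm_map] using hU) hc
    refine ⟨c, hc1, ?_⟩
    have hdc : d = J c := by
      ext y
      have hclosed : IsClosed {y : Y | d y = J c y} := isClosed_eq d.continuous (J c).continuous
      have hdense : Dense {y : Y | d y = J c y} := by
        have hsub : Set.range q ⊆ {y : Y | d y = J c y} := by
          rintro _ ⟨x, rfl⟩
          refine tendsto_nhds_unique (hd (q x)) ?_
          simpa only [hJq] using hc x
        refine Dense.mono hsub fun y => ?_
        rw [i.isometry.isEmbedding.closure_eq_preimage_closure_image, Set.mem_preimage,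
          ← Set.range_comp]
        have hRq : Set.range (i ∘ q) = Set.range R := congrArg Set.range (funext hq)
        rw [hRq]
        change i y ∈ closure (Set.range j.toContinuousLinearMap.flip)
        rw [← hi]
        exact ⟨y, rfl⟩
      have := hdense.closure_eq
      rw [hclosed.closure_eq] at this
      exact (Set.eq_univ_iff_forall.1 this) y
    rw [← hdc]
    exact hd
  let C : Set (WeakDual ℂ Y) := (fun m => StrongDual.toWeakDual (J m)) '' closedBall 0 1
  have hCclosed : IsClosed C := by
    refine isClosed_of_closure_subset fun g hg => ?_
    obtain ⟨V, hVC, hVg⟩ := mem_closure_iff_ultrafilter.1 hg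
    let U := Ultrafilter.ofComapInfPrincipal (m := fun m => StrongDual.toWeakDual (J m)) hVC
    have hU1 : closedBall 0 1 ∈ U := Ultrafilter.ofComapInfPrincipal_mem hVC
    have hU2 : U.map (fun m => StrongDual.toWeakDual (J m)) = V :=
      Ultrafilter.ofComapInfPrincipal_eq_of_map hVC
    obtain ⟨c, hc1, hc⟩ := hconv U (by filter_upwards [hU1] with m hm; simpa using hm)
    refine ⟨c, by simpa using hc1, ?_⟩
    refine DFunLike.ext _ _ fun y => ?_
    have h1 : Tendsto (fun m => StrongDual.toWeakDual (J m)) U (𝓝 g) := by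
      rw [← hU2] at hVg; exact hVg
    exact tendsto_nhds_unique (hc y) (((WeakDual.eval_continuous y).tendsto g).comp h1)
  have hCconv : Convex ℝ C := by
    have h1 : Convex ℝ (closedBall (0 : M) 1) := convex_closedBall 0 1
    exact h1.is_linear_image (f := fun m => StrongDual.toWeakDual (J m))
      ⟨fun a b => by simp, fun a b => by
        refine DFunLike.ext _ _ fun y => ?_
        change J (a • b) y = a • (J b y)
        rw [← Complex.coe_smul, map_smul]; rfl⟩
  -- Bipolar argument: a w*-continuous functional separating `g` from `C` is evaluation at some `y`.
  -- Since `J` is dual to the isometry `i`, the bound `s` on `C` dominates `‖y‖`, whereas `s < re (g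
  -- y) ≤ ‖y‖`.
  have hsurj1 : ∀ g : StrongDual ℂ Y, ‖g‖ ≤ 1 → ∃ m, J m = g := by
    intro g hg
    by_contra hne
    have hgC : StrongDual.toWeakDual g ∉ C := by
      rintro ⟨m, -, hm⟩
      exact hne ⟨m, StrongDual.toWeakDual.injective hm⟩
    have : IsScalarTower ℝ ℂ (WeakDual ℂ Y) := ⟨fun r z g => DFunLike.ext _ _ fun y => by
      change (r • z) * g y = (r : ℂ) * (z * g y)
      rw [Complex.real_smul, mul_assoc]⟩
    have : @LocallyConvexSpace ℝ (WeakDual ℂ Y) _ _ AddCommGroup.toAddCommMonoid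
        (Module.complexToReal _) _ :=
      (WeakDual.withSeminorms ℂ Y).toLocallyConvexSpace
    obtain ⟨F, s, hF1, hF2⟩ :=
      RCLike.geometric_hahn_banach_closed_point (𝕜 := ℂ) hCconv hCclosed hgC
    obtain ⟨y, hy⟩ := LinearMap.dualEmbedding_surjective (topDualPairing ℂ Y) F
    have hFy : ∀ h : StrongDual ℂ Y, F (StrongDual.toWeakDual h) = h y := by
      intro h; rw [← hy]; rfl
    have hys : ‖y‖ ≤ s := by
      have hs0 : 0 ≤ s := by
        have := hF1 0 ⟨0, by simp, by simp⟩
        simpa using this.le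
      rw [← i.norm_map]
      refine (i y).opNorm_le_of_unit_norm hs0 fun m hm => ?_
      by_cases h0 : i y m = 0
      · simpa [h0] using hs0
      -- A phase rotating `i y m` onto its modulus, so that a bound on real parts bounds the norm.
      let z : ℂ := (starRingEnd ℂ) (i y m) / ‖i y m‖
      have hz : ‖z‖ = 1 := by
        simp [z, h0]
      have := hF1 (StrongDual.toWeakDual (J (z • m))) ⟨z • m, by simp [norm_smul, hz, hm], rfl⟩
      rw [hFy, hJ, map_smul] at this
      have h3 : z • i y m = (‖i y m‖ : ℂ) := by
        have h4 : (‖i y m‖ : ℂ) ≠ 0 := by simpa using h0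
        simp only [z, smul_eq_mul]
        rw [div_mul_eq_mul_div, mul_comm, Complex.mul_conj, div_eq_iff h4,
          Complex.normSq_eq_norm_sq]
        push_cast; ring
      rw [h3] at this
      simpa using this.le
    rw [hFy] at hF2
    have h5 : RCLike.re (g y) ≤ ‖y‖ := by
      refine (RCLike.re_le_norm _).trans ((g.le_opNorm y).trans ?_)
      nlinarith [norm_nonneg y]
    linarith
  have hsurj : Function.Surjective J := by
    intro g
    obtain ⟨m, hm⟩ := hsurj1 (((‖g‖ + 1 : ℝ) : ℂ)⁻¹ • g) (by
      rw [norm_smul, norm_inv, Complex.norm_real, Real.norm_of_nonneg (by positivity),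
        inv_mul_le_iff₀ (by positivity)]
      linarith)
    refine ⟨((‖g‖ + 1 : ℝ) : ℂ) • m, ?_⟩
    have h0 : ((‖g‖ + 1 : ℝ) : ℂ) ≠ 0 := by
      exact_mod_cast (by positivity : (‖g‖ + 1 : ℝ) ≠ 0)
    rw [map_smul, hm, smul_inv_smul₀ h0]
  let Jl : M →ₗᵢ[ℂ] StrongDual ℂ Y := ⟨J, hJn⟩
  exact ⟨(LinearIsometryEquiv.ofSurjective Jl hsurj).symm⟩

/-- A normed space that embeds isometrically in a dual Banach space with a unit ball that is compact
for pointwise convergence is itself a dual Banach space. -/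
theorem LinearIsometry.exists_predual {M : Type u} [NormedAddCommGroup M] [NormedSpace ℂ M]
    (j : M →ₗᵢ[ℂ] StrongDual ℂ X)
    (hj : ∀ U : Ultrafilter M, (∀ᶠ m in (U : Filter M), ‖m‖ ≤ 1) →
      ∃ c : M, ∀ x, Tendsto (fun m => j m x) U (𝓝 (j c x))) :
    ∃ (Y : Type u) (_ : NormedAddCommGroup Y) (_ : NormedSpace ℂ Y) (_ : CompleteSpace Y),
      Nonempty (StrongDual ℂ Y ≃ₗᵢ[ℂ] M) := by
  let R : X →L[ℂ] StrongDual ℂ M := j.toContinuousLinearMap.flip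
  -- Taken inside the dual of `M`, the predual lies in the universe of `M`, whatever that of `X`.
  let Y : Submodule ℂ (StrongDual ℂ M) :=
    (LinearMap.range (R : X →ₗ[ℂ] StrongDual ℂ M)).topologicalClosure
  have hY : IsClosed (Y : Set (StrongDual ℂ M)) := Submodule.isClosed_topologicalClosure _
  refine ⟨Y, inferInstance, inferInstance, hY.completeSpace_coe,
    LinearIsometry.nonempty_dual_equiv j Y.subtypeₗᵢ ?_ hj⟩
  rw [Submodule.coe_subtypeₗᵢ, Submodule.coe_subtype, Subtype.range_coe]
  rfl

end WeakStar

/-! ### Row-contractive actions of continuous functions on a dual space. -/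

section RowContractiveAction

variable {K E X : Type*} [TopologicalSpace K] [NormedAddCommGroup E]
  [NormedSpace ℂ E] [NormedAddCommGroup X] [NormedSpace ℂ X]

/-- An action of the continuous functions on `K` on a normed space `E` such that every row of
functions with `∑ fᵢ² ≤ 1` acts contractively on the `ℓ²`-direct sum of copies of `E`. -/
def RowContractive (L : C(K, ℝ) →ₐ[ℝ] Module.End ℂ E) : Prop :=
  ∀ (n : ℕ) (f : Fin n → C(K, ℝ)) (a : Fin n → E), (∀ k, ∑ i, f i k ^ 2 ≤ 1) →
    ‖∑ i, L (f i) (a i)‖ ^ 2 ≤ ∑ i, ‖a i‖ ^ 2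

namespace RowContractive

variable {L : C(K, ℝ) →ₐ[ℝ] Module.End ℂ E}

theorem norm_apply_le_of_abs_le_one (hL : RowContractive L)
    {f : C(K, ℝ)} (hf : ∀ k, |f k| ≤ 1) (a : E) :
    ‖L f a‖ ≤ ‖a‖ := by
  have h := hL 1 (fun _ => f) (fun _ => a) (fun k => by simpa using hf k)
  simp only [Finset.univ_unique, Finset.sum_singleton] at h
  exact (sq_le_sq₀ (norm_nonneg _) (norm_nonneg _)).1 h

theorem norm_apply_le (hL : RowContractive L)
    {f : C(K, ℝ)} {r : ℝ} (hr : 0 < r) (hf : ∀ k, |f k| ≤ r) (a : E) :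
    ‖L f a‖ ≤ r * ‖a‖ := by
  have h := hL.norm_apply_le_of_abs_le_one (f := r⁻¹ • f) (fun k => by
    rw [ContinuousMap.smul_apply, smul_eq_mul, abs_mul, abs_of_pos (inv_pos.2 hr),
      inv_mul_le_iff₀ hr, mul_one]
    exact hf k) a
  have h2 : L f a = r • L (r⁻¹ • f) a := by
    rw [map_smul, LinearMap.smul_apply, smul_inv_smul₀ hr.ne']
  rw [h2, norm_smul, Real.norm_of_nonneg hr.le]
  exact mul_le_mul_of_nonneg_left h hr.le

/-- Limits of `f · a` for a bounded family `a` are annihilated by functions whose support is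
separated from that of `f`. -/
theorem apply_limit_eq_zero (hL : RowContractive L)
    (φ : E ≃ₗᵢ[ℂ] StrongDual ℂ X) {l : Filter E} [l.NeBot]
    (hl : ∀ᶠ a in l, ‖a‖ ≤ 1) {f g e : C(K, ℝ)} {y : E}
    (hy : ∀ x, Tendsto (fun a => φ (L f a) x) l (𝓝 (φ y x)))
    (hf : ∀ k, |f k| ≤ 1) (hg : ∀ k, |g k| ≤ 1) (he : ∀ k, 0 ≤ e k) (he1 : ∀ k, e k ≤ 1)
    (hfg : ∀ k, f k = 0 ∨ g k = 0) (hge : g * e = e) : L e y = 0 := by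
  -- As `f` and `g` have disjoint supports, the row `(f, g)` is contractive, giving `‖f a + t e y‖²
  -- ≤ 1 + t²‖e y‖²`, and in the limit `y` replaces `f a`. Cutting down by `w` then yields `(1 +
  -- t)²‖e y‖² ≤ 1 + t²‖e y‖²`, where the cross term must stay bounded as `t` grows.
  have key : ∀ t : ℝ, 0 < t → 2 * t * ‖L e y‖ ^ 2 ≤ 1 := by
    intro t ht
    have hge' : L g (L e y) = L e y := by
      rw [← Module.End.mul_apply, ← map_mul, hge]
    have hrow : ∀ a, ‖a‖ ≤ 1 → ‖L f a + t • L e y‖ ^ 2 ≤ 1 + t ^ 2 * ‖L e y‖ ^ 2 := by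
      intro a ha
      have h := hL 2 ![f, g] ![a, t • L e y] (fun k => by
        simp only [Fin.sum_univ_two, Matrix.cons_val_zero, Matrix.cons_val_one]
        rcases hfg k with h | h
        · simpa [h] using hg k
        · simpa [h] using hf k)
      simp only [Fin.sum_univ_two, Matrix.cons_val_zero, Matrix.cons_val_one] at h
      have h2 : L g (t • L e y) = t • L e y := by
        rw [← Complex.coe_smul, map_smul, hge']
      rw [h2, norm_smul (t : ℝ) (L e y), mul_pow, Real.norm_of_nonneg ht.le] at h
      have : ‖a‖ ^ 2 ≤ 1 := by nlinarith [norm_nonneg a]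
      linarith
    have hlim : ‖y + t • L e y‖ ≤ √(1 + t ^ 2 * ‖L e y‖ ^ 2) := by
      rw [← φ.norm_map]
      refine StrongDual.norm_le_of_tendsto_apply (l := l)
        (u := fun a => φ (L f a + t • L e y)) (Real.sqrt_nonneg _) ?_ fun x => ?_
      · filter_upwards [hl] with a ha
        rw [φ.norm_map]
        exact Real.le_sqrt_of_sq_le (hrow a ha)
      · simp only [map_add, add_apply]
        exact (hy x).add tendsto_const_nhds
    -- The function `(1 + t) e / (1 + t e)` carries `y + t e y` to `(1 + t) e y`.
    have hpos : ∀ k, 0 < 1 + t * e k := fun k => by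
      have := mul_nonneg ht.le (he k); linarith
    let w : C(K, ℝ) := ⟨fun k => (1 + t) * e k / (1 + t * e k),
      by
        refine Continuous.div (by fun_prop) (by fun_prop) fun k => (hpos k).ne'⟩
    have hw : ∀ k, |w k| ≤ 1 := fun k => by
      have h1 : w k = (1 + t) * e k / (1 + t * e k) := rfl
      have h2 : 0 ≤ (1 + t) * e k := mul_nonneg (by linarith) (he k)
      rw [h1, abs_of_nonneg (div_nonneg h2 (hpos k).le), div_le_one (hpos k)]
      linarith [he1 k]
    have hwe : w * (1 + t • e) = (1 + t) • e := by
      ext k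
      change (1 + t) * e k / (1 + t * e k) * (1 + t * e k) = (1 + t) * e k
      exact div_mul_cancel₀ _ (hpos k).ne'
    have hwy : L w (y + t • L e y) = (1 + t) • L e y := by
      have h1 : y + t • L e y = L (1 + t • e) y := by
        rw [map_add, map_one, map_smul]; rfl
      rw [h1, ← Module.End.mul_apply, ← map_mul, hwe, map_smul]; rfl
    have h3 := (hL.norm_apply_le_of_abs_le_one hw _).trans hlim
    rw [hwy, norm_smul, Real.norm_of_nonneg (by linarith)] at h3
    have h4 := Real.sq_sqrt (show 0 ≤ 1 + t ^ 2 * ‖L e y‖ ^ 2 by positivity)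
    have h5 : ((1 + t) * ‖L e y‖) ^ 2 ≤ 1 + t ^ 2 * ‖L e y‖ ^ 2 := by
      rw [← h4]
      exact pow_le_pow_left₀ (by positivity) h3 2
    nlinarith [sq_nonneg ‖L e y‖]
  by_contra h0
  have hn : 0 < ‖L e y‖ ^ 2 := by positivity
  have := key (1 / ‖L e y‖ ^ 2) (by positivity)
  rw [mul_assoc, one_div_mul_cancel hn.ne'] at this
  linarith

/-- Banach–Alaoglu supplies the limit; surjectivity of `φ` brings it back into `E`. -/
theorem exists_limit (hL : RowContractive L)
    (φ : E ≃ₗᵢ[ℂ] StrongDual ℂ X) (U : Ultrafilter E)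
    (hU : ∀ᶠ a in (U : Filter E), ‖a‖ ≤ 1) {f : C(K, ℝ)} {r : ℝ} (hr : 0 < r)
    (hf : ∀ k, |f k| ≤ r) :
    ∃ y : E, ‖y‖ ≤ r ∧ ∀ x, Tendsto (fun a => φ (L f a) x) U (𝓝 (φ y x)) := by
  have hb : ∀ᶠ a in (U : Filter E), ‖φ (L f a)‖ ≤ r := by
    filter_upwards [hU] with a ha
    rw [φ.norm_map]
    exact (hL.norm_apply_le hr hf a).trans (mul_le_of_le_one_right hr.le ha)
  obtain ⟨c, hc⟩ := U.exists_tendsto_apply_of_norm_le hb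
  refine ⟨φ.symm c, ?_, by simpa only [φ.apply_symm_apply] using hc⟩
  rw [φ.symm.norm_map]
  exact StrongDual.norm_le_of_tendsto_apply hr.le hb hc

/-- If a bounded family tends to `0` in the w*-topology, then so does its image under `f`. -/
theorem tendsto_apply_zero (hL : RowContractive L)
    (φ : E ≃ₗᵢ[ℂ] StrongDual ℂ X) (U : Ultrafilter E)
    (hU : ∀ᶠ a in (U : Filter E), ‖a‖ ≤ 1)
    (hU0 : ∀ x, Tendsto (fun a => φ a x) U (𝓝 0)) {f : C(K, ℝ)} (hf0 : ∀ k, 0 ≤ f k)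
    (hf1 : ∀ k, f k ≤ 1) (x : X) : Tendsto (fun a => φ (L f a) x) U (𝓝 0) := by
  obtain ⟨y, -, hy⟩ := hL.exists_limit φ U hU zero_lt_one
    (fun k => (abs_of_nonneg (hf0 k)).trans_le (hf1 k))
  suffices hy0 : y = 0 by simpa [hy0] using hy x
  have key : ∀ n : ℕ, 0 < n → ‖y‖ ^ 2 ≤ (n + 1 : ℝ) * (2 / n) ^ 2 := by
    intro n hn
    have hn' : (0 : ℝ) < n := by exact_mod_cast hn
    -- Here `s j` is the rescaled distance of `f` from the level `j / n`. The tents `g j = p j - p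
    -- (j + 1)` live on `|s j| ≤ 1`; `h j` is `1` there and vanishes for `|s j| ≥ 2`. The part `c j`
    -- has size at most `2 / n`, and `d j` vanishes for `|s j| ≤ 2`.
    let s : ℕ → C(K, ℝ) := fun j => ⟨fun k => n * f k - j, by fun_prop⟩
    let p : ℕ → C(K, ℝ) := fun j => ⟨fun k => max 0 (min 1 (s j k + 1)), by fun_prop⟩
    let h : ℕ → C(K, ℝ) := fun j => ⟨fun k => max 0 (min 1 (2 - |s j k|)), by fun_prop⟩
    let c : ℕ → C(K, ℝ) := fun j => ⟨fun k => (n : ℝ)⁻¹ * max (-2) (min 2 (s j k)), by fun_prop⟩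
    let d : ℕ → C(K, ℝ) := fun j =>
      ⟨fun k => (n : ℝ)⁻¹ * (s j k - max (-2) (min 2 (s j k))), by fun_prop⟩
    have hs : ∀ j k, s j k = n * f k - j := fun j k => rfl
    have hp : ∀ j k, p j k = max 0 (min 1 (s j k + 1)) := fun j k => rfl
    have hh : ∀ j k, h j k = max 0 (min 1 (2 - |s j k|)) := fun j k => rfl
    have hc : ∀ j k, c j k = (n : ℝ)⁻¹ * max (-2) (min 2 (s j k)) := fun j k => rfl
    have hd : ∀ j k, d j k = (n : ℝ)⁻¹ * (s j k - max (-2) (min 2 (s j k))) := fun j k => rfl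
    let g : ℕ → C(K, ℝ) := fun j => p j - p (j + 1)
    have hg : ∀ j k, g j k = max 0 (min 1 (s j k + 1)) - max 0 (min 1 (s j k)) := fun j k => by
      change p j k - p (j + 1) k = _
      rw [hp, hp, hs, hs]
      push_cast
      congr 3
      ring
    have hg0 : ∀ j k, 0 ≤ g j k := fun j k => by
      rw [hg]; generalize s j k = r; grind
    have hg1 : ∀ j k, g j k ≤ 1 := fun j k => by
      rw [hg]; generalize s j k = r; grind
    -- The sum telescopes to `p 0 - p (n + 1)`; since `0 ≤ f ≤ 1`, the levels `0, …, n` make these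
    -- terms `1` and `0`.
    have hsum : ∑ j : Fin (n + 1), g j = 1 := by
      rw [Fin.sum_univ_eq_sum_range (fun j => g j), Finset.sum_range_sub']
      ext k
      change p 0 k - p (n + 1) k = 1
      rw [hp, hp, hs, hs]
      push_cast
      have h0 := mul_nonneg hn'.le (hf0 k)
      have h1 : n * f k ≤ n := mul_le_of_le_one_right hn'.le (hf1 k)
      generalize n * f k = r at *
      rw [min_eq_left (by linarith),
        max_eq_left (a := (0 : ℝ)) ((min_le_right _ _).trans (by linarith))]
      norm_num
    have hA : ∀ j : Fin (n + 1), ∃ A : E, ‖A‖ ≤ 2 / n ∧ L (g j) y = L (g j) A := by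
      intro j
      have hjn : (j : ℝ) ≤ n := by exact_mod_cast Nat.lt_succ_iff.1 j.2
      obtain ⟨A, hA, hcA⟩ := hL.exists_limit φ U hU (f := c j) (r := 2 / n) (by positivity)
        (fun k => by
          rw [hc, abs_mul, abs_of_pos (inv_pos.2 hn'), inv_mul_eq_div]
          gcongr
          generalize s j k = r
          grind)
      have hd1 : ∀ k, |d j k| ≤ 1 := fun k => by
        have h0 := mul_nonneg hn'.le (hf0 k)
        have h1 : n * f k ≤ n := mul_le_of_le_one_right hn'.le (hf1 k)
        have h2 : |s j k| ≤ n := by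
          rw [hs, abs_le]
          constructor <;> linarith [(Nat.cast_nonneg j : (0 : ℝ) ≤ (j : ℕ))]
        rw [hd, abs_mul, abs_of_pos (inv_pos.2 hn'), inv_mul_le_iff₀ hn', mul_one]
        refine le_trans ?_ h2
        generalize s j k = r
        grind
      obtain ⟨D, -, hdD⟩ := hL.exists_limit φ U hU (f := d j) zero_lt_one hd1
      -- Locality with `h j` as separator: it is `1` on the support of `g j` and vanishes wherever
      -- `d j` does not.
      have hD : L (g j) D = 0 := by
        refine hL.apply_limit_eq_zero φ hU hdD hd1 (g := h j) ?_ (hg0 j) (hg1 j) ?_ ?_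
        · intro k
          rw [hh]; generalize s j k = r; grind
        · intro k
          rw [hh, hd, mul_eq_zero]
          generalize s j k = r
          grind
        · ext k
          rw [ContinuousMap.mul_apply, hh, hg]
          generalize s j k = r
          grind
      refine ⟨A, hA, ?_⟩
      have hf : f = ((j : ℝ) / n) • 1 + c j + d j := by
        ext k
        change f k = (j : ℝ) / n * 1 + c j k + d j k
        rw [hc, hd, ← sub_eq_zero]
        have : s j k = n * f k - j := hs j k
        generalize max (-2) (min 2 (s j k)) = m
        rw [this]
        field_simp
        ring
      have hyAD : y = A + D := by
        apply φ.injective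
        ext z
        refine tendsto_nhds_unique (hy z) ?_
        have h1 : ∀ a, φ (L f a) z =
            ((j : ℝ) / n : ℝ) • φ a z + φ (L (c j) a) z + φ (L (d j) a) z := by
          intro a
          conv_lhs => rw [hf]
          rw [map_add, map_add, map_smul, map_one]
          simp only [LinearMap.add_apply, map_add, add_apply, LinearMap.smul_apply,
            Module.End.one_apply]
          rw [← Complex.coe_smul, map_smul, ← Complex.coe_smul]
          rfl
        simp only [h1]
        have h2 := (((hU0 z).const_smul ((j : ℝ) / n : ℝ)).add (hcA z)).add (hdD z)
        simpa using h2
      rw [hyAD, map_add, hD, add_zero]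
    choose A hA hgA using hA
    have hyA : y = ∑ j : Fin (n + 1), L (g j) (A j) := by
      simp only [← hgA]
      rw [← LinearMap.sum_apply, ← map_sum, hsum, map_one, Module.End.one_apply]
    rw [hyA]
    -- The row bound is essential: `n + 1` terms of size `2 / n` do not become small under the
    -- triangle inequality, but their squares do. It applies because `∑ gⱼ² ≤ ∑ gⱼ = 1`.
    refine (hL (n + 1) (fun j => g j) A fun k => ?_).trans ?_
    · have h1 : ∑ j : Fin (n + 1), g j k = 1 := by
        have := DFunLike.congr_fun hsum k
        simpa using this
      rw [← h1]
      exact Finset.sum_le_sum fun j _ => by nlinarith [hg0 j k, hg1 j k]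
    · refine (Finset.sum_le_card_nsmul _ _ ((2 / n : ℝ) ^ 2) fun j _ =>
        pow_le_pow_left₀ (norm_nonneg _) (hA j) 2).trans_eq ?_
      simp
  have hlim : Tendsto (fun n : ℕ => (n + 1 : ℝ) * (2 / n) ^ 2) atTop (𝓝 0) := by
    have h1 : Tendsto (fun n : ℕ => 4 * (1 / (n : ℝ)) + 4 * (1 / (n : ℝ)) ^ 2) atTop
        (𝓝 (4 * 0 + 4 * 0 ^ 2)) :=
      (tendsto_one_div_atTop_nhds_zero_nat.const_mul 4).add
        ((tendsto_one_div_atTop_nhds_zero_nat.pow 2).const_mul 4)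
    rw [mul_zero, zero_pow two_ne_zero, mul_zero, add_zero] at h1
    refine h1.congr' ?_
    filter_upwards [eventually_gt_atTop 0] with n hn
    have hn' : (n : ℝ) ≠ 0 := by exact_mod_cast hn.ne'
    field_simp
    ring
  have h0 : ‖y‖ ^ 2 ≤ 0 := by
    refine ge_of_tendsto hlim ?_
    filter_upwards [eventually_gt_atTop 0] with n hn using key n hn
  exact norm_eq_zero.1 (pow_eq_zero_iff two_ne_zero |>.1 (le_antisymm h0 (sq_nonneg _)))

/-- Each `f` with values in the unit interval acts on `E` as the adjoint of a map on the predual. -/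
theorem exists_apply_eq (hL : RowContractive L)
    [CompleteSpace X] (φ : E ≃ₗᵢ[ℂ] StrongDual ℂ X) {f : C(K, ℝ)}
    (hf0 : ∀ k, 0 ≤ f k) (hf1 : ∀ k, f k ≤ 1) (x : X) :
    ∃ x' : X, ∀ a, φ (L f a) x = φ a x' := by
  let T : E →L[ℂ] E := (L f).mkContinuous 1
    (hL.norm_apply_le zero_lt_one fun k => (abs_of_nonneg (hf0 k)).trans_le (hf1 k))
  refine φ.exists_eq_apply_of_tendsto_zero
    ((φ.toLinearIsometry.toContinuousLinearMap.flip x).comp T) ?_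
  rw [tendsto_iff_ultrafilter]
  intro U hU
  rw [le_inf_iff, le_principal_iff, ← tendsto_iff_comap, tendsto_pi_nhds] at hU
  refine hL.tendsto_apply_zero φ U ?_ (fun z => hU.1 z) hf0 hf1 x
  filter_upwards [hU.2] with a ha
  simpa using ha

end RowContractive

/-- A map that is the adjoint of a map on the predual is w*-continuous. -/
theorem continuous_weakStarTopology_of_exists_apply_eq (φ : E ≃ₗᵢ[ℂ] StrongDual ℂ X) {T : E → E}
    (hT : ∀ x, ∃ x', ∀ a, φ (T a) x = φ a x') :
    Continuous[weakStarTopology φ, weakStarTopology φ] T := by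
  let _ := weakStarTopology φ
  refine continuous_induced_rng.2 (WeakDual.continuous_of_continuous_eval fun x => ?_)
  obtain ⟨x', hx'⟩ := hT x
  refine ((WeakDual.eval_continuous x').comp continuous_induced_dom).congr fun a => (hx' a).symm

end RowContractiveAction

/-! ### Operator Cauchy–Schwarz for selfadjoint rows. -/

section Operators

variable {H : Type*} [NormedAddCommGroup H] [InnerProductSpace ℂ H] [CompleteSpace H]

/-- The operator Cauchy–Schwarz inequality for a row of selfadjoint operators. -/
theorem ContinuousLinearMap.norm_sum_mul_sq_le {n : ℕ} (T S : Fin n → H →L[ℂ] H)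
    (hT : ∀ i, IsSelfAdjoint (T i)) :
    ‖∑ i, T i * S i‖ ^ 2 ≤ ‖∑ i, T i * T i‖ * ∑ i, ‖S i‖ ^ 2 := by
  set R := ∑ i, T i * S i
  set Q := ∑ i, T i * T i
  have hR : ∀ ξ, ‖R ξ‖ ^ 2 ≤ ‖Q‖ * (∑ i, ‖S i‖ ^ 2) * ‖ξ‖ ^ 2 := by
    intro ξ
    have hsa : ∀ i (η ζ : H), inner ℂ (T i η) ζ = inner ℂ η (T i ζ) := fun i η ζ => by
      rw [← ContinuousLinearMap.adjoint_inner_right, ← ContinuousLinearMap.star_eq_adjoint,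
        (hT i).star_eq]
    -- Selfadjointness moves each `T i` across the inner product. Scalar Cauchy–Schwarz and `∑ ‖T i
    -- η‖² = ⟪η, Q η⟫` at `η = R ξ` then leave a factor `‖R ξ‖²` to cancel.
    have h1 : ‖R ξ‖ ^ 2 ≤ ∑ i, ‖S i ξ‖ * ‖T i (R ξ)‖ := by
      have h2 : inner ℂ (R ξ) (R ξ) = ∑ i, inner ℂ (S i ξ) (T i (R ξ)) := by
        conv_lhs => enter [2]; rw [show R ξ = ∑ i, T i (S i ξ) by simp [R]]
        rw [sum_inner]
        exact Finset.sum_congr rfl fun i _ => hsa i _ _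
      have h3 : ‖R ξ‖ ^ 2 = ‖inner ℂ (R ξ) (R ξ)‖ := by
        rw [inner_self_eq_norm_sq_to_K]; simp
      rw [h3, h2]
      exact (norm_sum_le _ _).trans (Finset.sum_le_sum fun i _ => norm_inner_le_norm _ _)
    have h4 : (∑ i, ‖S i ξ‖ * ‖T i (R ξ)‖) ^ 2 ≤ (∑ i, ‖S i ξ‖ ^ 2) * ∑ i, ‖T i (R ξ)‖ ^ 2 :=
      Finset.sum_mul_sq_le_sq_mul_sq _ _ _
    have h5 : ∑ i, ‖T i (R ξ)‖ ^ 2 ≤ ‖Q‖ * ‖R ξ‖ ^ 2 := by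
      have h6 : ((∑ i, ‖T i (R ξ)‖ ^ 2 : ℝ) : ℂ) = inner ℂ (R ξ) (Q (R ξ)) := by
        simp only [Q, sum_apply, inner_sum]
        push_cast
        refine Finset.sum_congr rfl fun i _ => ?_
        change _ = inner ℂ (R ξ) (T i (T i (R ξ)))
        rw [← hsa, inner_self_eq_norm_sq_to_K]
        rfl
      have h7 : (∑ i, ‖T i (R ξ)‖ ^ 2 : ℝ) = ‖inner ℂ (R ξ) (Q (R ξ))‖ := by
        rw [← h6, Complex.norm_real, Real.norm_of_nonneg (by positivity)]
      rw [h7]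
      refine (norm_inner_le_norm _ _).trans ?_
      nlinarith [Q.le_opNorm (R ξ), norm_nonneg (R ξ)]
    have h8 : ∑ i, ‖S i ξ‖ ^ 2 ≤ (∑ i, ‖S i‖ ^ 2) * ‖ξ‖ ^ 2 := by
      rw [Finset.sum_mul]
      refine Finset.sum_le_sum fun i _ => ?_
      rw [← mul_pow]
      exact pow_le_pow_left₀ (norm_nonneg _) ((S i).le_opNorm ξ) 2
    have h9 : (‖R ξ‖ ^ 2) ^ 2 ≤ (‖Q‖ * (∑ i, ‖S i‖ ^ 2) * ‖ξ‖ ^ 2) * ‖R ξ‖ ^ 2 := by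
      calc (‖R ξ‖ ^ 2) ^ 2 ≤ (∑ i, ‖S i ξ‖ * ‖T i (R ξ)‖) ^ 2 :=
            pow_le_pow_left₀ (by positivity) h1 2
        _ ≤ (∑ i, ‖S i ξ‖ ^ 2) * ∑ i, ‖T i (R ξ)‖ ^ 2 := h4
        _ ≤ ((∑ i, ‖S i‖ ^ 2) * ‖ξ‖ ^ 2) * (‖Q‖ * ‖R ξ‖ ^ 2) :=
            mul_le_mul h8 h5 (by positivity) (by positivity)
        _ = _ := by ring
    by_cases h0 : ‖R ξ‖ ^ 2 = 0
    · rw [h0]; positivity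
    · have hpos : 0 < ‖R ξ‖ ^ 2 := lt_of_le_of_ne (sq_nonneg _) (Ne.symm h0)
      rw [sq (‖R ξ‖ ^ 2)] at h9
      exact le_of_mul_le_mul_right h9 hpos
  have hC : 0 ≤ ‖Q‖ * ∑ i, ‖S i‖ ^ 2 := by positivity
  have hle : ‖R‖ ≤ √(‖Q‖ * ∑ i, ‖S i‖ ^ 2) := by
    refine R.opNorm_le_bound (Real.sqrt_nonneg _) fun ξ => ?_
    refine le_of_sq_le_sq ?_ (by positivity)
    rw [mul_pow, Real.sq_sqrt hC]
    exact hR ξ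
  calc ‖R‖ ^ 2 ≤ √(‖Q‖ * ∑ i, ‖S i‖ ^ 2) ^ 2 := pow_le_pow_left₀ (norm_nonneg _) hle 2
    _ = _ := Real.sq_sqrt hC

/-- The operator Cauchy–Schwarz inequality, with the selfadjoint operators on the right. -/
theorem ContinuousLinearMap.norm_sum_mul_sq_le' {n : ℕ} (T S : Fin n → H →L[ℂ] H)
    (hT : ∀ i, IsSelfAdjoint (T i)) :
    ‖∑ i, S i * T i‖ ^ 2 ≤ ‖∑ i, T i * T i‖ * ∑ i, ‖S i‖ ^ 2 := by
  have h := ContinuousLinearMap.norm_sum_mul_sq_le T (fun i => star (S i)) hT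
  have h2 : ∑ i, T i * star (S i) = star (∑ i, S i * T i) := by
    rw [star_sum]
    exact Finset.sum_congr rfl fun i _ => by rw [star_mul, (hT i).star_eq]
  rw [h2, norm_star] at h
  simpa only [norm_star] using h

end Operators

/-! ### From row bounds to maps on the predual, by functional calculus. -/

section CStarAction

variable {A E X : Type*} [CStarAlgebra A] [NormedAddCommGroup E] [NormedSpace ℂ E]
  [NormedAddCommGroup X] [NormedSpace ℂ X] [CompleteSpace X]

/-- Let a unital C*-algebra act linearly on a dual Banach space, multiplicatively on commuting
elements, so that rows of selfadjoint elements satisfy the operator Cauchy–Schwarz inequality. Then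
every element acts as the adjoint of a map on the predual. -/
theorem CStarAlgebra.exists_apply_eq_of_row_bound (φ : E ≃ₗᵢ[ℂ] StrongDual ℂ X)
    (act : A →ₗ[ℂ] Module.End ℂ E) (hone : act 1 = 1)
    (hmul : ∀ a b, Commute a b → act (a * b) = act a * act b)
    (hrow : ∀ (n : ℕ) (T : Fin n → A) (e : Fin n → E), (∀ i, IsSelfAdjoint (T i)) →
      ‖∑ i, act (T i) (e i)‖ ^ 2 ≤ ‖∑ i, T i * T i‖ * ∑ i, ‖e i‖ ^ 2)
    (a : A) (x : X) : ∃ x' : X, ∀ e, φ (act a e) x = φ e x' := by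
  let _ := CStarAlgebra.spectralOrder A
  have _ := CStarAlgebra.spectralOrderedRing A
  -- The conclusion is linear in `a`, and positive contractions span a C*-algebra.
  have ha : a ∈ Submodule.span ℂ ({b : A | 0 ≤ b} ∩ closedBall 0 1) := by
    rw [CStarAlgebra.span_nonneg_inter_unitClosedBall]
    trivial
  induction ha using Submodule.span_induction generalizing x with
  | zero => exact ⟨0, fun e => by simp⟩
  | add b c _ _ hb hc =>
    obtain ⟨y, hy⟩ := hb x
    obtain ⟨z, hz⟩ := hc x
    exact ⟨y + z, fun e => by simp [hy, hz]⟩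
  | smul r b _ hb =>
    obtain ⟨y, hy⟩ := hb x
    exact ⟨r • y, fun e => by simp [hy]⟩
  | mem b hb =>
    have hb0 : 0 ≤ b := hb.1
    have hb1 : ‖b‖ ≤ 1 := by simpa using hb.2
    have hsa : IsSelfAdjoint b := .of_nonneg hb0
    let F : C(spectrum ℝ b, ℝ) →⋆ₐ[ℝ] A := cfcHom hsa
    have hFn : ∀ f, ‖F f‖ = ‖f‖ := fun f => norm_cfcHom b f hsa
    have hFsa : ∀ f, IsSelfAdjoint (F f) := fun f => by
      rw [IsSelfAdjoint, ← map_star, star_trivial]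
    let L : C(spectrum ℝ b, ℝ) →ₐ[ℝ] Module.End ℂ E :=
      AlgHom.ofLinearMap ((act.restrictScalars ℝ) ∘ₗ F.toAlgHom.toLinearMap)
        (by
          change act (F 1) = 1
          rw [map_one, hone])
        (fun f g => by
          change act (F (f * g)) = act (F f) * act (F g)
          rw [map_mul]
          exact hmul _ _ (by rw [Commute, SemiconjBy, ← map_mul, ← map_mul, mul_comm]))
    have hLF : ∀ f, L f = act (F f) := fun f => rfl
    have hL : RowContractive L := by
      intro n f e hf
      have h := hrow n (fun i => F (f i)) e fun i => hFsa _
      have h1 : ‖∑ i, F (f i) * F (f i)‖ ≤ 1 := by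
        simp only [← map_mul, ← map_sum]
        rw [hFn, ContinuousMap.norm_le _ zero_le_one]
        intro k
        have h2 := hf k
        have h3 : (∑ i, f i * f i) k = ∑ i, f i k ^ 2 := by
          simp [sq]
        rw [h3, Real.norm_of_nonneg (Finset.sum_nonneg fun i _ => sq_nonneg _)]
        exact h2
      simp only [hLF]
      exact h.trans (mul_le_of_le_one_left (by positivity) h1)
    have hid : F (.restrict (spectrum ℝ b) (.id ℝ)) = b := cfcHom_id hsa
    obtain ⟨x', hx'⟩ := hL.exists_apply_eq φ (f := .restrict (spectrum ℝ b) (.id ℝ))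
      (fun k => spectrum_nonneg_of_nonneg hb0 k.2)
      (fun k => (le_abs_self _).trans ((ContinuousMap.norm_coe_le_norm _ k).trans
        (((hFn _).symm.trans (congrArg norm hid)).trans_le hb1))) x
    refine ⟨x', fun e => ?_⟩
    rw [← hx', hLF, hid]

end CStarAction

/-! ### The diagonal: its two actions and its predual. -/

namespace UnitalOperatorAlgebra

variable {H : Type u} [NormedAddCommGroup H] [InnerProductSpace ℂ H] [CompleteSpace H]
  {X : Type v} [NormedAddCommGroup X] [NormedSpace ℂ X] (B : UnitalOperatorAlgebra H)

noncomputable instance : NormedSpace ℂ B.toNonUnitalSubalgebra where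
  norm_smul_le c a := norm_smul_le c (a : H →L[ℂ] H)

/-- The inclusion of the diagonal in the algebra. -/
noncomputable def inclusion : B.diagonal →ₗ[ℂ] B.toNonUnitalSubalgebra where
  toFun a := ⟨a, (mem_diagonal.1 a.2).1⟩
  map_add' _ _ := rfl
  map_smul' _ _ := rfl

/-- The diagonal acting on the algebra by multiplication on the left. -/
noncomputable def leftAction : B.diagonal →ₗ[ℂ] Module.End ℂ B.toNonUnitalSubalgebra :=
  LinearMap.mul ℂ B.toNonUnitalSubalgebra ∘ₗ B.inclusion

/-- The diagonal acting on the algebra by multiplication on the right. -/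
noncomputable def rightAction : B.diagonal →ₗ[ℂ] Module.End ℂ B.toNonUnitalSubalgebra :=
  (LinearMap.mul ℂ B.toNonUnitalSubalgebra).flip ∘ₗ B.inclusion

variable {B}

theorem norm_sum_diagonal {n : ℕ} (T : Fin n → B.diagonal) :
    ‖∑ i, T i * T i‖ = ‖∑ i, (T i : H →L[ℂ] H) * (T i : H →L[ℂ] H)‖ := by
  have h : ((∑ i, T i * T i : B.diagonal) : H →L[ℂ] H) =
      ∑ i, (T i : H →L[ℂ] H) * (T i : H →L[ℂ] H) :=
    map_sum (NonUnitalStarSubalgebraClass.subtype B.diagonal) _ _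
  rw [← h]
  rfl

theorem isSelfAdjoint_coe {a : B.diagonal} (ha : IsSelfAdjoint a) :
    IsSelfAdjoint (a : H →L[ℂ] H) :=
  congrArg Subtype.val ha

theorem coe_sum {n : ℕ} (e : Fin n → B.toNonUnitalSubalgebra) :
    ((∑ i, e i : B.toNonUnitalSubalgebra) : H →L[ℂ] H) = ∑ i, (e i : H →L[ℂ] H) :=
  map_sum (NonUnitalSubalgebraClass.subtype B.toNonUnitalSubalgebra) _ _

theorem exists_leftAction_eq [CompleteSpace X]
    (φ : B.toNonUnitalSubalgebra ≃ₗᵢ[ℂ] StrongDual ℂ X) (b : B.diagonal) (x : X) :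
    ∃ x' : X, ∀ a, φ (B.leftAction b a) x = φ a x' := by
  refine CStarAlgebra.exists_apply_eq_of_row_bound (E := B.toNonUnitalSubalgebra) φ
    B.leftAction ?_ ?_ ?_ b x
  · ext a
    exact congrArg (fun T : H →L[ℂ] H => T _) (B.unit_mul _ a.2)
  · intro a b _
    exact LinearMap.ext fun c => Subtype.ext (mul_assoc (a : H →L[ℂ] H) b c)
  · intro n T e hT
    rw [norm_sum_diagonal]
    change ‖((∑ i, B.leftAction (T i) (e i) : B.toNonUnitalSubalgebra) : H →L[ℂ] H)‖ ^ 2 ≤ _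
    rw [coe_sum]
    exact ContinuousLinearMap.norm_sum_mul_sq_le (fun i => (T i : H →L[ℂ] H))
      (fun i => (e i : H →L[ℂ] H)) fun i => isSelfAdjoint_coe (hT i)

theorem exists_rightAction_eq [CompleteSpace X]
    (φ : B.toNonUnitalSubalgebra ≃ₗᵢ[ℂ] StrongDual ℂ X) (b : B.diagonal) (x : X) :
    ∃ x' : X, ∀ a, φ (B.rightAction b a) x = φ a x' := by
  refine CStarAlgebra.exists_apply_eq_of_row_bound (E := B.toNonUnitalSubalgebra) φ
    B.rightAction ?_ ?_ ?_ b x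
  · ext a
    exact congrArg (fun T : H →L[ℂ] H => T _) (B.mul_unit _ a.2)
  · intro a b hab
    -- Right multiplication reverses products; commutativity restores the order.
    rw [hab.eq]
    exact LinearMap.ext fun c => Subtype.ext (mul_assoc (c : H →L[ℂ] H) b a).symm
  · intro n T e hT
    rw [norm_sum_diagonal]
    change ‖((∑ i, B.rightAction (T i) (e i) : B.toNonUnitalSubalgebra) : H →L[ℂ] H)‖ ^ 2 ≤ _
    rw [coe_sum]
    exact ContinuousLinearMap.norm_sum_mul_sq_le' (fun i => (T i : H →L[ℂ] H))
      (fun i => (e i : H →L[ℂ] H)) fun i => isSelfAdjoint_coe (hT i)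

/-- By the C*-identity: the cross terms `± itb` cancel, leaving `1 + t² b²`. -/
theorem norm_unit_add_smul_le {b : H →L[ℂ] H} (hb : b ∈ B.toNonUnitalSubalgebra)
    (hsa : IsSelfAdjoint b) (hb1 : ‖b‖ ≤ 1) (t : ℝ) :
    ‖B.unit + (t * Complex.I) • b‖ ≤ √(1 + t ^ 2) := by
  have h : star (B.unit + (t * Complex.I) • b) * (B.unit + (t * Complex.I) • b) =
      B.unit + (t ^ 2 : ℂ) • (b * b) := by
    have hub := B.unit_mul b hb
    have hbu := B.mul_unit b hb
    have huu := B.unit_mul _ B.unit_mem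
    have hst : star ((t : ℂ) * Complex.I) = -(t * Complex.I) := by
      simp
    rw [star_add, star_smul, B.star_unit, hsa.star_eq, hst, add_mul, mul_add, mul_add, huu,
      smul_mul_assoc, mul_smul_comm, hub, hbu, smul_mul_smul_comm]
    have : -((t : ℂ) * Complex.I) * (t * Complex.I) = t ^ 2 := by
      linear_combination (-(t : ℂ) ^ 2) * Complex.I_sq
    rw [this, neg_smul]
    abel
  refine Real.le_sqrt_of_sq_le ?_
  rw [sq, ← CStarRing.norm_star_mul_self, h]
  refine (norm_add_le _ _).trans (add_le_add B.norm_unit_le ?_)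
  rw [norm_smul, norm_pow, Complex.norm_real, Real.norm_eq_abs, sq_abs]
  refine mul_le_of_le_one_right (sq_nonneg t) ((norm_mul_le _ _).trans ?_)
  exact mul_le_one₀ hb1 (norm_nonneg _) hb1

/-- The bounds make the numerical range real on the range of the identity of `B`. That identity is a
selfadjoint projection absorbed by `b` on both sides, so this range suffices. -/
theorem isSelfAdjoint_of_norm_unit_add_smul_le {b : H →L[ℂ] H}
    (hb : b ∈ B.toNonUnitalSubalgebra)
    (h : ∀ t : ℝ, ‖B.unit + (t * Complex.I) • b‖ ≤ √(1 + t ^ 2)) : IsSelfAdjoint b := by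
  have hreal : ∀ ξ : H, B.unit ξ = ξ → (inner ℂ ξ (b ξ)).im = 0 := by
    intro ξ hξ
    set q := (inner ℂ ξ (b ξ)).im
    -- `t q` is bounded by `‖ξ‖² (√(1 + t²) - 1)`, which is of second order in `t`.
    have h1 : ∀ t : ℝ, -(t * q) ≤ t ^ 2 * ‖ξ‖ ^ 2 := by
      intro t
      have h2 : RCLike.re (inner ℂ ξ ((B.unit + (t * Complex.I) • b) ξ)) = ‖ξ‖ ^ 2 - t * q := by
        have h3 : (B.unit + (t * Complex.I) • b) ξ = ξ + (t * Complex.I) • b ξ := by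
          change B.unit ξ + (t * Complex.I) • b ξ = _
          rw [hξ]
        rw [h3, inner_add_right, inner_smul_right, inner_self_eq_norm_sq_to_K, map_add]
        have h4 : RCLike.re ((t * Complex.I) * inner ℂ ξ (b ξ)) = -(t * q) := by
          simp [q, mul_assoc]
        rw [h4]
        norm_cast
      have h5 : RCLike.re (inner ℂ ξ ((B.unit + (t * Complex.I) • b) ξ)) ≤
          √(1 + t ^ 2) * ‖ξ‖ ^ 2 := by
        refine (RCLike.re_le_norm _).trans ((norm_inner_le_norm _ _).trans ?_)
        have := ContinuousLinearMap.le_of_opNorm_le _ (h t) ξ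
        nlinarith [norm_nonneg ξ]
      have h6 : √(1 + t ^ 2) ≤ 1 + t ^ 2 := by
        rw [Real.sqrt_le_left (by positivity)]
        nlinarith [sq_nonneg t, sq_nonneg (t ^ 2)]
      rw [h2] at h5
      nlinarith [sq_nonneg ‖ξ‖]
    by_contra hq
    have hN : 0 < ‖ξ‖ ^ 2 + 1 := by positivity
    -- Near-optimal `t` in `-tq ≤ t²‖ξ‖²`; the `+ 1` keeps the denominator positive and the
    -- contradiction strict.
    have h7 := h1 (-q / (‖ξ‖ ^ 2 + 1))
    have h8 : 0 < q ^ 2 := by positivity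
    have h9 : -(-q / (‖ξ‖ ^ 2 + 1) * q) = q ^ 2 / (‖ξ‖ ^ 2 + 1) := by ring
    rw [h9, div_pow, neg_sq, div_mul_eq_mul_div, div_le_div_iff₀ hN (by positivity)] at h7
    nlinarith [mul_pos h8 hN]
  rw [ContinuousLinearMap.isSelfAdjoint_iff_isSymmetric,
    LinearMap.isSymmetric_iff_inner_map_self_real]
  intro ξ
  have hub := B.unit_mul b hb
  have hbu := B.mul_unit b hb
  have huu := B.unit_mul _ B.unit_mem
  have e1 : inner ℂ ξ (b ξ) = inner ℂ (B.unit ξ) (b (B.unit ξ)) := by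
    have h1 : b (B.unit ξ) = b ξ := congrArg (fun T : H →L[ℂ] H => T ξ) hbu
    have h2 : B.unit (b ξ) = b ξ := congrArg (fun T : H →L[ℂ] H => T ξ) hub
    rw [h1, ← ContinuousLinearMap.adjoint_inner_right, ← ContinuousLinearMap.star_eq_adjoint,
      B.star_unit, h2]
  have h3 := hreal (B.unit ξ) (congrArg (fun T : H →L[ℂ] H => T ξ) huu)
  rw [← e1] at h3
  have h4 : (starRingEnd ℂ) (inner ℂ ξ (b ξ)) = inner ℂ ξ (b ξ) := Complex.conj_eq_iff_im.2 h3
  change (starRingEnd ℂ) (inner ℂ (b ξ) ξ) = inner ℂ (b ξ) ξ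
  rw [inner_conj_symm, ← h4, inner_conj_symm]

/-- Bounded w*-limits of selfadjoint elements are selfadjoint. -/
theorem exists_limit_mem_diagonal (φ : B.toNonUnitalSubalgebra ≃ₗᵢ[ℂ] StrongDual ℂ X)
    {α : Type*} (U : Ultrafilter α) {u : α → B.toNonUnitalSubalgebra}
    (hsa : ∀ a, IsSelfAdjoint (u a : H →L[ℂ] H)) (hu : ∀ᶠ a in (U : Filter α), ‖u a‖ ≤ 1) :
    ∃ c : B.diagonal, ∀ x, Tendsto (fun a => φ (u a) x) U (𝓝 (φ (B.inclusion c) x)) := by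
  obtain ⟨d, hd⟩ := U.exists_tendsto_apply_of_norm_le (u := fun a => φ (u a)) (r := 1)
    (by simpa only [φ.norm_map] using hu)
  obtain ⟨c, rfl⟩ := φ.surjective d
  let e : B.toNonUnitalSubalgebra := ⟨B.unit, B.unit_mem⟩
  have hc : IsSelfAdjoint (c : H →L[ℂ] H) := by
    refine isSelfAdjoint_of_norm_unit_add_smul_le c.2 fun t => ?_
    change ‖e + ((t : ℂ) * Complex.I) • c‖ ≤ _
    rw [← φ.norm_map]
    refine StrongDual.norm_le_of_tendsto_apply (l := (U : Filter α))
      (u := fun a => φ (e + ((t : ℂ) * Complex.I) • u a)) (Real.sqrt_nonneg _) ?_ fun x => ?_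
    · filter_upwards [hu] with a ha
      rw [φ.norm_map]
      exact norm_unit_add_smul_le (u a).2 (hsa a) ha t
    · simp only [map_add, map_smul, add_apply, smul_apply]
      exact tendsto_const_nhds.add ((hd x).const_smul _)
  exact ⟨⟨c, mem_diagonal.2 ⟨c.2, by rw [hc.star_eq]; exact c.2⟩⟩, hd⟩

/-- The diagonal of a unital operator algebra that is a dual Banach space is a dual Banach space. -/
theorem wStarAlgebra_diagonal (φ : B.toNonUnitalSubalgebra ≃ₗᵢ[ℂ] StrongDual ℂ X) :
    WStarAlgebra B.diagonal := by
  let ι : B.diagonal →ₗᵢ[ℂ] B.toNonUnitalSubalgebra := ⟨B.inclusion, fun _ => rfl⟩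
  let j : B.diagonal →ₗᵢ[ℂ] StrongDual ℂ X := φ.toLinearIsometry.comp ι
  -- Taking real and imaginary parts is contractive, so each has a limit in the diagonal along `U`.
  obtain ⟨Y, i1, i2, i3, ⟨e⟩⟩ := j.exists_predual (fun U hU => by
    obtain ⟨c, hc⟩ := exists_limit_mem_diagonal φ U (u := fun m => B.inclusion (ℜ m : B.diagonal))
      (fun m => isSelfAdjoint_coe (ℜ m).2) (by
        filter_upwards [hU] with m hm
        exact (realPart.norm_le m).trans hm)
    obtain ⟨d, hd⟩ := exists_limit_mem_diagonal φ U (u := fun m => B.inclusion (ℑ m : B.diagonal))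
      (fun m => isSelfAdjoint_coe (ℑ m).2) (by
        filter_upwards [hU] with m hm
        exact (imaginaryPart.norm_le m).trans hm)
    refine ⟨c + Complex.I • d, fun x => ?_⟩
    have h1 : ∀ m, j m x = φ (B.inclusion (ℜ m : B.diagonal)) x +
        Complex.I • φ (B.inclusion (ℑ m : B.diagonal)) x := by
      intro m
      conv_lhs => rw [← realPart_add_I_smul_imaginaryPart m, map_add, map_smul]
      rfl
    rw [map_add, map_smul, funext h1]
    exact (hc x).add ((hd x).const_smul Complex.I))
  -- `WStarAlgebra` asks for a conjugate-linear identification; composing with the involution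
  -- provides it.
  exact ⟨⟨Y, i1, i2, i3, ⟨e.trans (starₗᵢ ℂ)⟩⟩⟩

end UnitalOperatorAlgebra

end

theorem proposition3p5 {H : Type u} [NormedAddCommGroup H] [InnerProductSpace ℂ H]
    [CompleteSpace H] (B : UnitalOperatorAlgebra H)
    {X : Type v} [NormedAddCommGroup X] [NormedSpace ℂ X] [CompleteSpace X]
    (φ : B.toNonUnitalSubalgebra ≃ₗᵢ[ℂ] StrongDual ℂ X) :
    WStarAlgebra B.diagonal ∧
      ∀ b : B.toNonUnitalSubalgebra, (b : H →L[ℂ] H) ∈ B.diagonal →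
        Continuous[weakStarTopology φ, weakStarTopology φ]
            (fun a : B.toNonUnitalSubalgebra => a * b) ∧
          Continuous[weakStarTopology φ, weakStarTopology φ]
            (fun a : B.toNonUnitalSubalgebra => b * a) := by
  refine ⟨UnitalOperatorAlgebra.wStarAlgebra_diagonal φ, fun b hb => ⟨?_, ?_⟩⟩
  · exact continuous_weakStarTopology_of_exists_apply_eq (E := B.toNonUnitalSubalgebra) φ
      (UnitalOperatorAlgebra.exists_rightAction_eq φ ⟨b, hb⟩)
  · exact continuous_weakStarTopology_of_exists_apply_eq (E := B.toNonUnitalSubalgebra) φ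
      (UnitalOperatorAlgebra.exists_leftAction_eq φ ⟨b, hb⟩)
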